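/- Theorem 3 (No-joint steerability of one mode by multimode Gaussian measurements). Consider a continuous-variable system of $n=n_A+n_B+n_C$ modes with Hilbert space $L^2(\mathbb{R}^n)$, partitioned into three groups $A$, $B$, $C$ of $n_A$, $n_B$, $n_C$ modes, where $n_A, n_C$ are arbitrary and $n_B=1$. Let $R=(q_1,p_1,\dots,q_n,p_n)$ be the canonical operators, $q_j$ being multiplication by $x_j$ and $p_j=-i\,\partial/\partial x_j$. Let $\rho_{ABC}$ be an arbitrary (Gaussian or non-Gaussian) quantum state, i.e. a positive operator of trace one on $L^2(\mathbb{R}^n)$, with finite second moments $\mathrm{tr}[\rho R_j^2]<\infty$ for all $j$, and let $V_{ABC}$ be its covariance matrix, $$V_{jk}=\mathrm{tr}\big[\rho\,\big((R_j-d_j)(R_k-d_k)+(R_k-d_k)(R_j-d_j)\big)\big],\qquad d_j=\mathrm{tr}[\rho R_j].$$ For groups of modes $X$, $Y$ let $V_X$ and $V_{XY}=\begin{pmatrix}V_X&V_{\mathrm{off}}\\V_{\mathrm{off}}^T&V_Y\end{pmatrix}$ denote the corresponding principal blocks of $V_{ABC}$ (the covariance matrices of the subsystems), and let $\bar V_{XY\backslash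 X}=V_Y-V_{\mathrm{off}}^TV_X^{-1}V_{\mathrm{off}}$ be the Schur complement of $V_X$ in $V_{XY}$. Say that $\rho_{ABC}$ is $X\to Y$ steerable by Gaussian measurements (as detected by its covariance matrix) if this Schur complement is not a bona fide covariance matrix, i.e. if $$\bar V_{XY\backslash X}+i\,\sigma^{\oplus n_Y}\not\ge 0,\qquad \sigma=\begin{pmatrix}0&1\\-1&0\end{pmatrix}.$$ Then $\rho_{ABC}$ cannot be simultaneously $A\to B$ and $C\to B$ steerable by Gaussian measurements. -/

import Mathlib

open scoped Kronecker Topology ComplexOrder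

noncomputable section

namespace CVSteering

/-! ### The Hilbert space of finitely many modes and its canonical operators -/

/-- The Hilbert space `L²(ℝ^ι)` of a system of modes labelled by `ι` (Schrödinger
representation). -/
abbrev Hilb (ι : Type) [Fintype ι] : Type :=
  MeasureTheory.Lp ℂ 2 (MeasureTheory.volume : MeasureTheory.Measure (ι → ℝ))

section Operators

variable {ι : Type} [Fintype ι]

/-- The position operator `q_j`: multiplication by the coordinate `x_j`, on its maximal domain
`{ψ | x_j ψ ∈ L²}`. -/
def position (j : ι) : Hilb ι →ₗ.[ℂ] Hilb ι where
  domain :=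
    { carrier := {ψ | MeasureTheory.MemLp (fun x : ι → ℝ => (x j : ℂ) * ψ x) 2
        MeasureTheory.volume}
      zero_mem' := by
        refine (MeasureTheory.MemLp.zero (ε := ℂ)).ae_eq ?_
        filter_upwards [MeasureTheory.Lp.coeFn_zero ℂ 2
          (MeasureTheory.volume : MeasureTheory.Measure (ι → ℝ))] with x hx
        simp
      add_mem' := by
        intro ψ φ hψ hφ
        refine (MeasureTheory.MemLp.add hψ hφ).ae_eq ?_
        filter_upwards [MeasureTheory.Lp.coeFn_add ψ φ] with x hx
        simp only [hx, Pi.add_apply, mul_add]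
      smul_mem' := by
        intro c ψ hψ
        refine (MeasureTheory.MemLp.const_smul hψ c).ae_eq ?_
        filter_upwards [MeasureTheory.Lp.coeFn_smul c ψ] with x hx
        simp [hx, mul_left_comm] }
  toFun :=
    { toFun := fun ψ => MeasureTheory.MemLp.toLp _ ψ.2
      map_add' := by
        intro ψ φ
        rw [← MeasureTheory.MemLp.toLp_add]
        refine MeasureTheory.MemLp.toLp_congr _ _ ?_
        filter_upwards [MeasureTheory.Lp.coeFn_add (ψ : Hilb ι) (φ : Hilb ι)] with x hx
        simp only [hx, Pi.add_apply, mul_add, Submodule.coe_add]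
      map_smul' := by
        intro c ψ
        rw [RingHom.id_apply, ← MeasureTheory.MemLp.toLp_const_smul]
        refine MeasureTheory.MemLp.toLp_congr _ _ ?_
        filter_upwards [MeasureTheory.Lp.coeFn_smul c (ψ : Hilb ι)] with x hx
        simp [hx, mul_left_comm] }

/-- The translation `(T_{j,t} ψ)(x) = ψ(x + t e_j)` of `L²(ℝ^ι)`. -/
def translation [DecidableEq ι] (j : ι) (t : ℝ) : Hilb ι →ₗᵢ[ℂ] Hilb ι :=
  MeasureTheory.Lp.compMeasurePreservingₗᵢ ℂ (fun x : ι → ℝ => x + (Pi.single j t : ι → ℝ))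
    (MeasureTheory.measurePreserving_add_right MeasureTheory.volume
      (Pi.single j t : ι → ℝ))

/-- The difference quotient `t⁻¹ (T_{j,t} ψ - ψ)`. -/
def diffQuot [DecidableEq ι] (j : ι) (ψ : Hilb ι) (t : ℝ) : Hilb ι :=
  ((t : ℂ)⁻¹) • (translation j t ψ - ψ)

theorem diffQuot_add [DecidableEq ι] (j : ι) (ψ φ : Hilb ι) :
    diffQuot j (ψ + φ) = fun t => diffQuot j ψ t + diffQuot j φ t := by
  funext t
  simp only [diffQuot, map_add, ← smul_add]
  congr 1
  abel

theorem diffQuot_smul [DecidableEq ι] (j : ι) (c : ℂ) (ψ : Hilb ι) :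
    diffQuot j (c • ψ) = fun t => c • diffQuot j ψ t := by
  funext t
  simp only [diffQuot, map_smul, ← smul_sub]
  rw [smul_comm]

/-- The momentum operator `p_j = -i ∂/∂x_j`, the self-adjoint generator of the translations along
the `j`-th axis: its domain consists of the `ψ` for which the difference quotients converge in
`L²`, to a limit `∂_j ψ`, and there `p_j ψ = -i ∂_j ψ`. -/
def momentum [DecidableEq ι] (j : ι) : Hilb ι →ₗ.[ℂ] Hilb ι where
  domain :=
    { carrier := {ψ | ∃ φ, Filter.Tendsto (diffQuot j ψ) (𝓝[≠] 0) (𝓝 φ)}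
      zero_mem' := by
        refine ⟨0, ?_⟩
        have h : diffQuot j (0 : Hilb ι) = fun _ => 0 := by
          funext t
          simp [diffQuot]
        rw [h]
        exact tendsto_const_nhds
      add_mem' := by
        rintro ψ φ ⟨a, ha⟩ ⟨b, hb⟩
        exact ⟨a + b, by rw [diffQuot_add]; exact ha.add hb⟩
      smul_mem' := by
        rintro c ψ ⟨a, ha⟩
        exact ⟨c • a, by rw [diffQuot_smul]; exact ha.const_smul c⟩ }
  toFun :=
    { toFun := fun ψ => (-Complex.I) • Classical.choose ψ.2
      map_add' := by
        intro ψ φ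
        rw [← smul_add]
        congr 1
        refine tendsto_nhds_unique (Classical.choose_spec (ψ + φ).2) ?_
        rw [Submodule.coe_add, diffQuot_add]
        exact (Classical.choose_spec ψ.2).add (Classical.choose_spec φ.2)
      map_smul' := by
        intro c ψ
        rw [RingHom.id_apply, smul_comm c]
        congr 1
        refine tendsto_nhds_unique (Classical.choose_spec (c • ψ).2) ?_
        rw [Submodule.coe_smul, diffQuot_smul]
        exact (Classical.choose_spec ψ.2).const_smul c }

/-- The canonical operators `R_(j,0) = q_j` and `R_(j,1) = p_j`. -/
def quadrature [DecidableEq ι] (r : ι × Fin 2) : Hilb ι →ₗ.[ℂ] Hilb ι :=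
  if r.2 = 0 then position r.1 else momentum r.1

end Operators

/-! ### Quantum states and their second moments -/

/-- Index set of a fixed orthonormal (Hilbert) basis of `L²(ℝ^ι)`. -/
def basisIndex (ι : Type) [Fintype ι] : Set (Hilb ι) :=
  Classical.choose (exists_hilbertBasis ℂ (Hilb ι))

/-- A fixed orthonormal (Hilbert) basis of `L²(ℝ^ι)`. It is only used to write traces of positive
operators and inner products of Hilbert-Schmidt operators, which do not depend on the basis. -/
def onb (ι : Type) [Fintype ι] : HilbertBasis (basisIndex ι) ℂ (Hilb ι) :=
  Classical.choose (Classical.choose_spec (exists_hilbertBasis ℂ (Hilb ι)))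

/-- The positive square root `√T` of a positive bounded operator `T` on a Hilbert space. -/
def opSqrt {H : Type} [NormedAddCommGroup H] [InnerProductSpace ℂ H] [CompleteSpace H]
    (T : H →L[ℂ] H) : H →L[ℂ] H :=
  CFC.sqrt T

/-- A quantum state of the modes `ι`: a positive operator of trace one on `L²(ℝ^ι)`. -/
structure QuantumState (ι : Type) [Fintype ι] where
  /-- the density operator -/
  op : Hilb ι →L[ℂ] Hilb ι
  isPositive : op.IsPositive
  trace_one : HasSum (fun i => inner ℂ (onb ι i) (op (onb ι i))) 1

namespace QuantumState

variable {ι : Type} [Fintype ι] [DecidableEq ι]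

/-- The vector `√ρ e_i`, where `e_i` is the `i`-th vector of the orthonormal basis. -/
def amp (ρ : QuantumState ι) (i : basisIndex ι) : Hilb ι :=
  opSqrt ρ.op (onb ι i)

/-- The state has finite second moments, `tr[ρ R_r²] < ∞` for every canonical operator `R_r`: the
operator `R_r √ρ` is everywhere defined and Hilbert-Schmidt. -/
structure HasFiniteSecondMoments (ρ : QuantumState ι) : Prop where
  mem_domain : ∀ (r : ι × Fin 2) (ψ : Hilb ι), opSqrt ρ.op ψ ∈ (quadrature r).domain
  summable : ∀ r : ι × Fin 2, Summable fun i : basisIndex ι =>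
    ‖quadrature r ⟨opSqrt ρ.op (onb ι i), mem_domain r (onb ι i)⟩‖ ^ 2

/-- The vector `R_r √ρ e_i`. -/
def quadAmp (ρ : QuantumState ι) (h : ρ.HasFiniteSecondMoments) (r : ι × Fin 2)
    (i : basisIndex ι) : Hilb ι :=
  quadrature r ⟨ρ.amp i, h.mem_domain r (onb ι i)⟩

/-- The first moment `d_r = tr[ρ R_r] = ∑_i ⟨√ρ e_i, R_r √ρ e_i⟩`. -/
def mean (ρ : QuantumState ι) (h : ρ.HasFiniteSecondMoments) (r : ι × Fin 2) : ℝ :=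
  (∑' i, inner ℂ (ρ.amp i) (ρ.quadAmp h r i)).re

/-- The vector `(R_r - d_r) √ρ e_i`. -/
def centredAmp (ρ : QuantumState ι) (h : ρ.HasFiniteSecondMoments) (r : ι × Fin 2)
    (i : basisIndex ι) : Hilb ι :=
  ρ.quadAmp h r i - (ρ.mean h r : ℂ) • ρ.amp i

/-- The covariance matrix `V_rs = tr[ρ {R_r - d_r, R_s - d_s}]`, where `{X, Y} = X Y + Y X` and
`tr[ρ X Y] = ∑_i ⟨X √ρ e_i, Y √ρ e_i⟩` for self-adjoint `X, Y`. In this normalization the vacuum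
has the identity matrix as covariance matrix. -/
def covMatrix (ρ : QuantumState ι) (h : ρ.HasFiniteSecondMoments) :
    Matrix (ι × Fin 2) (ι × Fin 2) ℝ :=
  Matrix.of fun r s =>
    (∑' i, (inner ℂ (ρ.centredAmp h r i) (ρ.centredAmp h s i)
      + inner ℂ (ρ.centredAmp h s i) (ρ.centredAmp h r i))).re

end QuantumState

/-! ### Symplectic form, bona fide condition, Schur complements and steering -/

/-- The symplectic form `σ^{⊕ n}` with `σ = !![0, 1; -1, 0]`, for the modes `β`. -/
def symplecticForm (β : Type) [DecidableEq β] : Matrix (β × Fin 2) (β × Fin 2) ℝ :=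
  (1 : Matrix β β ℝ) ⊗ₖ !![0, 1; -1, 0]

/-- The bona fide condition `V + i σ^{⊕ n} ≥ 0`. -/
def IsBonaFide {β : Type} [DecidableEq β] (V : Matrix (β × Fin 2) (β × Fin 2) ℝ) : Prop :=
  (V.map Complex.ofReal + Complex.I • (symplecticForm β).map Complex.ofReal).PosSemidef

/-- The block of `V` with rows in the modes selected by `a` and columns in those selected
by `b`. -/
def block {ι α β : Type} (V : Matrix (ι × Fin 2) (ι × Fin 2) ℝ) (a : α → ι) (b : β → ι) :
    Matrix (α × Fin 2) (β × Fin 2) ℝ :=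
  V.submatrix (Prod.map a id) (Prod.map b id)

/-- The Schur complement `V_B - V_offᵀ V_A⁻¹ V_off` of `V_A` in `V_AB`, where `A` and `B` consist
of the modes selected by `a` and `b`. -/
def schurComplement {ι α β : Type} [Fintype α] [DecidableEq α]
    (V : Matrix (ι × Fin 2) (ι × Fin 2) ℝ) (a : α → ι) (b : β → ι) :
    Matrix (β × Fin 2) (β × Fin 2) ℝ :=
  block V b b - (block V a b).transpose * (block V a a)⁻¹ * block V a b

/-- The state `ρ` is `A → B` steerable by Gaussian measurements (as detected by its second
moments): the Schur complement of `V_A` in `V_AB` violates the bona fide condition. The disjoint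
groups of modes `A` and `B` are given by injections `a` and `b` into the set of all modes. -/
def GaussianSteerable {ι α β : Type} [Fintype ι] [DecidableEq ι] [Fintype α] [DecidableEq α]
    [DecidableEq β] (ρ : QuantumState ι) (h : ρ.HasFiniteSecondMoments)
    (a : α → ι) (b : β → ι) : Prop :=
  ¬ IsBonaFide (schurComplement (ρ.covMatrix h) a b)

end CVSteering

end

/-! Put `c r = (R_r - d_r)√ρ`, a Hilbert-Schmidt operator, encoded as the square-summable family of
its values on the basis. Finite second moments and the canonical commutation relations give `2⟨c r,
c s⟩ = V_rs + i σ_rs`. From here on only this Gram matrix matters (`covMatrix_eq_re_inner`,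
`symplecticForm_eq_im_inner`).

Let M and N be the Schur complements of `V_A` and `V_C`. For real coefficients x on B, `xᵀMx` is
twice the squared norm of the B-combination plus a suitable A-combination (`norm_sq_schurMin`);
likewise for y, N and C. Operators of different groups commute, so twice the imaginary part of the
inner product of the two corrected vectors is still `xᵀσy`. Cauchy-Schwarz gives `(xᵀσy)² ≤
(xᵀMx)(yᵀNy)` (`sq_symplecticForm_le`).

For one mode this inequality forces `det M * det N ≥ 1`, so one determinant is at least 1. A
positive single-mode matrix of determinant at least 1 is bona fide (`isBonaFide_singleMode`). -/

namespace CVSteering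

/-! ### Commutation relations of position and momentum in weak form -/

section Operators

variable {ι : Type} [Fintype ι] [DecidableEq ι]

theorem translation_ae (j : ι) (t : ℝ) (ψ : Hilb ι) :
    (translation j t ψ : (ι → ℝ) → ℂ) =ᵐ[MeasureTheory.volume]
      fun x => ψ (x + (Pi.single j t : ι → ℝ)) :=
  MeasureTheory.Lp.coeFn_compMeasurePreserving ψ _

theorem translation_translation_ae (j k : ι) (s t : ℝ) (ψ : Hilb ι) :
    (translation j s (translation k t ψ) : (ι → ℝ) → ℂ) =ᵐ[MeasureTheory.volume]
      fun x => ψ (x + (Pi.single j s : ι → ℝ) + (Pi.single k t : ι → ℝ)) := by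
  refine (translation_ae j s _).trans ?_
  exact (MeasureTheory.measurePreserving_add_right MeasureTheory.volume
    (Pi.single j s : ι → ℝ)).quasiMeasurePreserving.ae_eq_comp (translation_ae k t ψ)

theorem translation_comm (j k : ι) (s t : ℝ) (ψ : Hilb ι) :
    translation j s (translation k t ψ) = translation k t (translation j s ψ) := by
  refine MeasureTheory.Lp.ext ?_
  filter_upwards [translation_translation_ae j k s t ψ, translation_translation_ae k j t s ψ]
    with x h₁ h₂
  rw [h₁, h₂, add_right_comm]

theorem translation_translation_neg (j : ι) (t : ℝ) (ψ : Hilb ι) :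
    translation j t (translation j (-t) ψ) = ψ := by
  refine MeasureTheory.Lp.ext ?_
  filter_upwards [translation_translation_ae j j t (-t) ψ] with x h
  rw [h, add_assoc, ← Pi.single_add]
  simp

theorem inner_translation_left (j : ι) (t : ℝ) (ψ φ : Hilb ι) :
    inner ℂ (translation j t ψ) φ = inner ℂ ψ (translation j (-t) φ) := by
  conv_lhs => rw [← translation_translation_neg j t φ]
  exact (translation j t).inner_map_map _ _

theorem inner_translation_right (j : ι) (t : ℝ) (ψ φ : Hilb ι) :
    inner ℂ ψ (translation j t φ) = inner ℂ (translation j (-t) ψ) φ := by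
  rw [inner_translation_left, neg_neg]

omit [DecidableEq ι] in
theorem position_ae (j : ι) (ψ : (position j : Hilb ι →ₗ.[ℂ] Hilb ι).domain) :
    (position j ψ : (ι → ℝ) → ℂ) =ᵐ[MeasureTheory.volume]
      fun x => (x j : ℂ) * (ψ : Hilb ι) x :=
  MeasureTheory.MemLp.coeFn_toLp ψ.2

omit [DecidableEq ι] in
-- The primed vectors are the unprimed ones seen in the other operator's domain. Stated with inner
-- products, commutation never needs the domain of a product of operators.
theorem inner_position_comm (j k : ι) (ψ : (position j : Hilb ι →ₗ.[ℂ] Hilb ι).domain)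
    (φ : (position k : Hilb ι →ₗ.[ℂ] Hilb ι).domain)
    (ψ' : (position k : Hilb ι →ₗ.[ℂ] Hilb ι).domain)
    (φ' : (position j : Hilb ι →ₗ.[ℂ] Hilb ι).domain)
    (hψ : (ψ : Hilb ι) = ψ') (hφ : (φ : Hilb ι) = φ') :
    inner ℂ (position j ψ) (position k φ) = inner ℂ (position k ψ') (position j φ') := by
  simp only [MeasureTheory.L2.inner_def]
  refine MeasureTheory.integral_congr_ae ?_
  filter_upwards [position_ae j ψ, position_ae k φ, position_ae k ψ', position_ae j φ']
    with x h₁ h₂ h₃ h₄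
  rw [h₁, h₂, h₃, h₄, hψ, hφ]
  simp only [RCLike.inner_apply, map_mul, Complex.conj_ofReal]
  ring

omit [DecidableEq ι] in
theorem inner_position_left (j : ι) (ψ φ : (position j : Hilb ι →ₗ.[ℂ] Hilb ι).domain) :
    inner ℂ (position j ψ) (φ : Hilb ι) = inner ℂ (ψ : Hilb ι) (position j φ) := by
  simp only [MeasureTheory.L2.inner_def]
  refine MeasureTheory.integral_congr_ae ?_
  filter_upwards [position_ae j ψ, position_ae j φ] with x h₁ h₂
  rw [h₁, h₂]
  simp only [RCLike.inner_apply, map_mul, Complex.conj_ofReal]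
  ring

/-- Translating shifts the position operator by a multiple of the identity. -/
theorem inner_position_translation (j k : ι) (t : ℝ)
    (ψ φ : (position k : Hilb ι →ₗ.[ℂ] Hilb ι).domain) :
    inner ℂ (position k ψ) (translation j t (φ : Hilb ι)) =
      inner ℂ (translation j (-t) (ψ : Hilb ι)) (position k φ)
        - (if j = k then (t : ℂ) else 0) * inner ℂ (translation j (-t) (ψ : Hilb ι)) (φ : Hilb ι) := by
  rw [inner_translation_right, ← inner_smul_right, ← inner_sub_right]
  simp only [MeasureTheory.L2.inner_def]
  refine MeasureTheory.integral_congr_ae ?_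
  have h₀ := (MeasureTheory.measurePreserving_add_right MeasureTheory.volume
    (Pi.single j (-t) : ι → ℝ)).quasiMeasurePreserving.ae_eq_comp (position_ae k ψ)
  filter_upwards [h₀, translation_ae j (-t) (position k ψ), translation_ae j (-t) (ψ : Hilb ι),
    position_ae k φ,
    MeasureTheory.Lp.coeFn_sub (position k φ) ((if j = k then (t : ℂ) else 0) • (φ : Hilb ι)),
    MeasureTheory.Lp.coeFn_smul (if j = k then (t : ℂ) else 0) (φ : Hilb ι)]
    with x h₀ h₁ h₂ h₃ h₄ h₅
  simp only [Function.comp_apply] at h₀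
  rw [h₁, h₀, h₂, h₄, Pi.sub_apply, h₃, h₅, Pi.smul_apply]
  by_cases h : j = k
  · subst h
    simp only [RCLike.inner_apply, map_mul, Complex.conj_ofReal, smul_eq_mul, Pi.add_apply,
      Pi.single_eq_same, if_true]
    push_cast
    ring
  · simp only [RCLike.inner_apply, map_mul, Complex.conj_ofReal, smul_eq_mul, Pi.add_apply,
      Pi.single_eq_of_ne (Ne.symm h), if_neg h]
    push_cast
    ring

theorem momentum_spec (j : ι) (ψ : (momentum j : Hilb ι →ₗ.[ℂ] Hilb ι).domain) :
    ∃ φ, Filter.Tendsto (diffQuot j (ψ : Hilb ι)) (𝓝[≠] 0) (𝓝 φ) ∧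
      momentum j ψ = (-Complex.I) • φ :=
  ⟨_, Classical.choose_spec ψ.2, rfl⟩

theorem tendsto_neg_nhdsNE_zero :
    Filter.Tendsto (fun t : ℝ => -t) (𝓝[≠] 0) (𝓝[≠] 0) := by
  refine tendsto_nhdsWithin_iff.2 ⟨?_, ?_⟩
  · have : Filter.Tendsto (fun t : ℝ => -t) (𝓝 0) (𝓝 0) := by
      simpa using (continuous_neg (G := ℝ)).tendsto 0
    exact this.mono_left nhdsWithin_le_nhds
  · filter_upwards [self_mem_nhdsWithin] with t ht
    simpa using ht

theorem tendsto_translation_of_diffQuot {j : ι} {ψ φ : Hilb ι}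
    (h : Filter.Tendsto (diffQuot j ψ) (𝓝[≠] 0) (𝓝 φ)) :
    Filter.Tendsto (fun t => translation j t ψ) (𝓝[≠] 0) (𝓝 ψ) := by
  have h₁ : Filter.Tendsto (fun t : ℝ => (t : ℂ)) (𝓝[≠] 0) (𝓝 0) := by
    have : Filter.Tendsto (fun t : ℝ => (t : ℂ)) (𝓝 0) (𝓝 0) := by
      simpa using Complex.continuous_ofReal.tendsto 0
    exact this.mono_left nhdsWithin_le_nhds
  have h₂ := (h₁.smul h).add_const ψ
  rw [zero_smul, zero_add] at h₂
  refine h₂.congr' ?_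
  filter_upwards [self_mem_nhdsWithin] with t ht
  have ht' : (t : ℂ) ≠ 0 := by simpa using ht
  rw [diffQuot, smul_inv_smul₀ ht', sub_add_cancel]

/-- Translations commute and the adjoint of a translation is its inverse, so exchanging the two axes
costs only the sign of `t`. The limit `t → 0` yields the commutation of momenta. -/
theorem inner_diffQuot_diffQuot (j k : ι) (t : ℝ) (ψ φ : Hilb ι) :
    inner ℂ (diffQuot j ψ t) (diffQuot k φ t) =
      inner ℂ (diffQuot k ψ (-t)) (diffQuot j φ (-t)) := by
  have h : inner ℂ (translation k (-t) ψ) (translation j (-t) φ) =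
      inner ℂ (translation j t ψ) (translation k t φ) := by
    rw [inner_translation_left, inner_translation_left, neg_neg, translation_comm]
  simp only [diffQuot, inner_smul_left, inner_smul_right, inner_sub_left, inner_sub_right, h,
    inner_translation_left j t ψ φ, inner_translation_right k t ψ φ, map_inv₀, map_neg,
    Complex.conj_ofReal, Complex.ofReal_neg, inv_neg]
  ring

theorem inner_momentum_comm (j k : ι) (ψ : (momentum j : Hilb ι →ₗ.[ℂ] Hilb ι).domain)
    (φ : (momentum k : Hilb ι →ₗ.[ℂ] Hilb ι).domain)
    (ψ' : (momentum k : Hilb ι →ₗ.[ℂ] Hilb ι).domain)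
    (φ' : (momentum j : Hilb ι →ₗ.[ℂ] Hilb ι).domain)
    (hψ : (ψ : Hilb ι) = ψ') (hφ : (φ : Hilb ι) = φ') :
    inner ℂ (momentum j ψ) (momentum k φ) = inner ℂ (momentum k ψ') (momentum j φ') := by
  obtain ⟨a, ha, ha'⟩ := momentum_spec j ψ
  obtain ⟨b, hb, hb'⟩ := momentum_spec k φ
  obtain ⟨c, hc, hc'⟩ := momentum_spec k ψ'
  obtain ⟨d, hd, hd'⟩ := momentum_spec j φ'
  rw [ha', hb', hc', hd']
  simp only [inner_smul_left, inner_smul_right]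
  congr 2
  refine tendsto_nhds_unique (ha.inner hb) ?_
  refine ((hc.comp tendsto_neg_nhdsNE_zero).inner (hd.comp tendsto_neg_nhdsNE_zero)).congr ?_
  intro t
  rw [hψ, hφ, Function.comp_apply, Function.comp_apply, ← inner_diffQuot_diffQuot]

theorem inner_momentum_left (j : ι) (ψ φ : (momentum j : Hilb ι →ₗ.[ℂ] Hilb ι).domain) :
    inner ℂ (momentum j ψ) (φ : Hilb ι) = inner ℂ (ψ : Hilb ι) (momentum j φ) := by
  obtain ⟨a, ha, ha'⟩ := momentum_spec j ψ
  obtain ⟨b, hb, hb'⟩ := momentum_spec j φ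
  rw [ha', hb', inner_smul_left, inner_smul_right]
  have h : inner ℂ a (φ : Hilb ι) = -inner ℂ (ψ : Hilb ι) b := by
    refine tendsto_nhds_unique (ha.inner tendsto_const_nhds) ?_
    refine ((tendsto_const_nhds (x := (ψ : Hilb ι))).inner
      (hb.comp tendsto_neg_nhdsNE_zero)).neg.congr ?_
    intro t
    simp only [Function.comp_apply, diffQuot, inner_smul_left, inner_smul_right, inner_sub_left,
      inner_sub_right, inner_translation_left, map_inv₀, Complex.conj_ofReal, Complex.ofReal_neg,
      inv_neg]
    ring
  rw [h]
  simp

theorem inner_position_momentum (j k : ι) (ψ : (position k : Hilb ι →ₗ.[ℂ] Hilb ι).domain)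
    (φ : (momentum j : Hilb ι →ₗ.[ℂ] Hilb ι).domain)
    (ψ' : (momentum j : Hilb ι →ₗ.[ℂ] Hilb ι).domain)
    (φ' : (position k : Hilb ι →ₗ.[ℂ] Hilb ι).domain)
    (hψ : (ψ : Hilb ι) = ψ') (hφ : (φ : Hilb ι) = φ') :
    inner ℂ (position k ψ) (momentum j φ) - inner ℂ (momentum j ψ') (position k φ') =
      Complex.I * (if j = k then 1 else 0) * inner ℂ (ψ : Hilb ι) (φ : Hilb ι) := by
  obtain ⟨a, ha, ha'⟩ := momentum_spec j φ
  obtain ⟨b, hb, hb'⟩ := momentum_spec j ψ'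
  -- Moving the translation across the inner product shifts `q_k` by `t` when `j = k`. Divided by
  -- `t`, this shift leaves the extra term, whose limit needs the continuity of translations at
  -- `ψ'`.
  have h : inner ℂ (position k ψ) a =
      -inner ℂ b (position k φ') - (if j = k then 1 else 0) * inner ℂ (ψ' : Hilb ι) (φ' : Hilb ι) := by
    refine tendsto_nhds_unique ((tendsto_const_nhds (x := position k ψ)).inner ha) ?_
    have hT := (tendsto_translation_of_diffQuot hb).comp tendsto_neg_nhdsNE_zero
    refine Filter.Tendsto.congr' ?_
      (((hb.comp tendsto_neg_nhdsNE_zero).inner (tendsto_const_nhds (x := position k φ'))).neg.sub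
      ((hT.inner (tendsto_const_nhds (x := (φ' : Hilb ι)))).const_mul
        (if j = k then (1 : ℂ) else 0)))
    filter_upwards [self_mem_nhdsWithin] with t ht
    have ht' : (t : ℂ) ≠ 0 := by simpa using ht
    have hp : inner ℂ (position k ψ) (φ : Hilb ι) = inner ℂ (ψ' : Hilb ι) (position k φ') := by
      rw [hφ, inner_position_left, hψ]
    simp only [Function.comp_apply, diffQuot, inner_smul_left, inner_smul_right, inner_sub_left,
      inner_sub_right, map_inv₀, map_neg, Complex.conj_ofReal, Complex.ofReal_neg, inv_neg, hp]
    rw [hφ, inner_position_translation, hψ]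
    split_ifs
    · field_simp
      ring
    · ring
  rw [ha', hb', inner_smul_left, inner_smul_right, h, hψ, hφ]
  simp only [map_neg, Complex.conj_I]
  ring

theorem inner_quadrature_left (r : ι × Fin 2)
    (ψ φ : (quadrature r : Hilb ι →ₗ.[ℂ] Hilb ι).domain) :
    inner ℂ (quadrature r ψ) (φ : Hilb ι) = inner ℂ (ψ : Hilb ι) (quadrature r φ) := by
  obtain ⟨j, i⟩ := r
  fin_cases i
  · exact inner_position_left j ψ φ
  · exact inner_momentum_left j ψ φ

/-- The canonical commutation relations `[R_r, R_s] = i σ_rs`, in the form sense. -/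
theorem inner_quadrature_sub (r s : ι × Fin 2) (ψ φ : Hilb ι)
    (hψr : ψ ∈ (quadrature r : Hilb ι →ₗ.[ℂ] Hilb ι).domain)
    (hψs : ψ ∈ (quadrature s : Hilb ι →ₗ.[ℂ] Hilb ι).domain)
    (hφr : φ ∈ (quadrature r : Hilb ι →ₗ.[ℂ] Hilb ι).domain)
    (hφs : φ ∈ (quadrature s : Hilb ι →ₗ.[ℂ] Hilb ι).domain) :
    inner ℂ (quadrature r ⟨ψ, hψr⟩) (quadrature s ⟨φ, hφs⟩)
        - inner ℂ (quadrature s ⟨ψ, hψs⟩) (quadrature r ⟨φ, hφr⟩) =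
      Complex.I * (symplecticForm ι r s : ℂ) * inner ℂ ψ φ := by
  obtain ⟨j, i⟩ := r
  obtain ⟨k, l⟩ := s
  fin_cases i <;> fin_cases l
  · refine (sub_eq_zero.2 (inner_position_comm j k ⟨ψ, hψr⟩ ⟨φ, hφs⟩ ⟨ψ, hψs⟩ ⟨φ, hφr⟩
      rfl rfl)).trans ?_
    simp [symplecticForm]
  · refine (inner_position_momentum k j ⟨ψ, hψr⟩ ⟨φ, hφs⟩ ⟨ψ, hψs⟩ ⟨φ, hφr⟩ rfl rfl).trans ?_
    by_cases h : j = k <;> simp [symplecticForm, h, eq_comm (a := k)]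
  · rw [← neg_sub]
    refine (congrArg Neg.neg
      (inner_position_momentum j k ⟨ψ, hψs⟩ ⟨φ, hφr⟩ ⟨ψ, hψr⟩ ⟨φ, hφs⟩ rfl rfl)).trans ?_
    by_cases h : j = k <;> simp [symplecticForm, h]
  · refine (sub_eq_zero.2 (inner_momentum_comm j k ⟨ψ, hψr⟩ ⟨φ, hφs⟩ ⟨ψ, hψs⟩ ⟨φ, hφr⟩
      rfl rfl)).trans ?_
    simp [symplecticForm]

end Operators

end CVSteering

/-! ### The covariance matrix as a Gram matrix of Hilbert-Schmidt operators -/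

namespace CVSteering

theorem inner_opSqrt_opSqrt {H : Type} [NormedAddCommGroup H] [InnerProductSpace ℂ H]
    [CompleteSpace H] {T : H →L[ℂ] H} (hT : T.IsPositive) (x : H) :
    inner ℂ (opSqrt T x) (opSqrt T x) = inner ℂ x (T x) := by
  have h₁ : (opSqrt T).IsPositive :=
    (ContinuousLinearMap.nonneg_iff_isPositive _).1 (CFC.sqrt_nonneg _)
  have h₂ : opSqrt T * opSqrt T = T :=
    CFC.sqrt_mul_sqrt_self _ ((ContinuousLinearMap.nonneg_iff_isPositive _).2 hT)
  rw [h₁.isSymmetric.apply_clm, ← mul_apply_eq_comp, h₂]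

namespace QuantumState

variable {ι : Type} [Fintype ι]

theorem inner_amp (ρ : QuantumState ι) (i : basisIndex ι) :
    inner ℂ (ρ.amp i) (ρ.amp i) = inner ℂ (onb ι i) (ρ.op (onb ι i)) := by
  exact inner_opSqrt_opSqrt ρ.isPositive _

theorem memℓp_amp (ρ : QuantumState ι) : Memℓp ρ.amp 2 := by
  refine (memℓp_gen_iff (by norm_num)).2 ?_
  have h := (Complex.hasSum_re ρ.trace_one).summable
  refine h.congr fun i => ?_
  rw [← inner_amp, ← RCLike.re_eq_complex_re, inner_self_eq_norm_sq]
  norm_num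

variable [DecidableEq ι]

theorem memℓp_quadAmp (ρ : QuantumState ι) (h : ρ.HasFiniteSecondMoments) (r : ι × Fin 2) :
    Memℓp (ρ.quadAmp h r) 2 := by
  refine (memℓp_gen_iff (by norm_num)).2 ?_
  refine (h.summable r).congr fun i => ?_
  norm_num
  rfl

/-- The family `√ρ e_i`, representing the Hilbert-Schmidt operator `√ρ`. -/
noncomputable def ampLp (ρ : QuantumState ι) : lp (fun _ : basisIndex ι => Hilb ι) 2 :=
  ⟨ρ.amp, ρ.memℓp_amp⟩

/-- The family `R_r √ρ e_i`, representing the Hilbert-Schmidt operator `R_r √ρ`. -/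
noncomputable def quadAmpLp (ρ : QuantumState ι) (h : ρ.HasFiniteSecondMoments) (r : ι × Fin 2) :
    lp (fun _ : basisIndex ι => Hilb ι) 2 :=
  ⟨ρ.quadAmp h r, ρ.memℓp_quadAmp h r⟩

/-- The family `(R_r - d_r) √ρ e_i`, representing a Hilbert-Schmidt operator. -/
noncomputable def centredAmpLp (ρ : QuantumState ι) (h : ρ.HasFiniteSecondMoments) (r : ι × Fin 2) :
    lp (fun _ : basisIndex ι => Hilb ι) 2 :=
  ρ.quadAmpLp h r - (ρ.mean h r : ℂ) • ρ.ampLp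

omit [DecidableEq ι] in
theorem inner_ampLp_self (ρ : QuantumState ι) : inner ℂ ρ.ampLp ρ.ampLp = 1 := by
  refine (lp.hasSum_inner _ _).unique (ρ.trace_one.congr_fun ?_)
  exact fun i => ρ.inner_amp i

theorem inner_quadAmpLp_ampLp (ρ : QuantumState ι) (h : ρ.HasFiniteSecondMoments)
    (r : ι × Fin 2) : inner ℂ (ρ.quadAmpLp h r) ρ.ampLp = inner ℂ ρ.ampLp (ρ.quadAmpLp h r) := by
  rw [lp.inner_eq_tsum, lp.inner_eq_tsum]
  exact tsum_congr fun i => inner_quadrature_left r ⟨ρ.amp i, h.mem_domain r _⟩ ⟨ρ.amp i, _⟩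

theorem inner_quadAmpLp_sub (ρ : QuantumState ι) (h : ρ.HasFiniteSecondMoments)
    (r s : ι × Fin 2) :
    inner ℂ (ρ.quadAmpLp h r) (ρ.quadAmpLp h s) - inner ℂ (ρ.quadAmpLp h s) (ρ.quadAmpLp h r) =
      Complex.I * (symplecticForm ι r s : ℂ) := by
  have h₁ := (lp.hasSum_inner (𝕜 := ℂ) (ρ.quadAmpLp h r) (ρ.quadAmpLp h s)).sub
    (lp.hasSum_inner (𝕜 := ℂ) (ρ.quadAmpLp h s) (ρ.quadAmpLp h r))
  have h₂ := (lp.hasSum_inner (𝕜 := ℂ) ρ.ampLp ρ.ampLp).mul_left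
    (Complex.I * (symplecticForm ι r s : ℂ))
  rw [inner_ampLp_self, mul_one] at h₂
  refine h₁.unique (h₂.congr_fun fun i => ?_)
  exact inner_quadrature_sub r s (ρ.amp i) (ρ.amp i) (h.mem_domain r _) (h.mem_domain s _)
    (h.mem_domain r _) (h.mem_domain s _)

/-- Subtracting real multiples of the identity does not change a commutator: the mixed terms cancel
by symmetry of each `R_r` (`inner_quadAmpLp_ampLp`). -/
theorem inner_centredAmpLp_sub (ρ : QuantumState ι) (h : ρ.HasFiniteSecondMoments)
    (r s : ι × Fin 2) :
    inner ℂ (ρ.centredAmpLp h r) (ρ.centredAmpLp h s)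
        - inner ℂ (ρ.centredAmpLp h s) (ρ.centredAmpLp h r) =
      Complex.I * (symplecticForm ι r s : ℂ) := by
  rw [← inner_quadAmpLp_sub ρ h]
  simp only [centredAmpLp, inner_sub_left, inner_sub_right, inner_smul_left, inner_smul_right,
    inner_quadAmpLp_ampLp, Complex.conj_ofReal]
  ring

theorem covMatrix_eq_re_inner (ρ : QuantumState ι) (h : ρ.HasFiniteSecondMoments)
    (r s : ι × Fin 2) :
    ρ.covMatrix h r s = 2 * (inner ℂ (ρ.centredAmpLp h r) (ρ.centredAmpLp h s)).re := by
  have h₁ := (lp.hasSum_inner (𝕜 := ℂ) (ρ.centredAmpLp h r) (ρ.centredAmpLp h s)).add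
    (lp.hasSum_inner (𝕜 := ℂ) (ρ.centredAmpLp h s) (ρ.centredAmpLp h r))
  refine (congrArg Complex.re h₁.tsum_eq).trans ?_
  rw [Complex.add_re, ← inner_conj_symm (ρ.centredAmpLp h s), Complex.conj_re]
  ring

theorem symplecticForm_eq_im_inner (ρ : QuantumState ι) (h : ρ.HasFiniteSecondMoments)
    (r s : ι × Fin 2) :
    symplecticForm ι r s = 2 * (inner ℂ (ρ.centredAmpLp h r) (ρ.centredAmpLp h s)).im := by
  have h₁ := congrArg Complex.im (inner_centredAmpLp_sub ρ h r s)
  rw [Complex.sub_im, ← inner_conj_symm (ρ.centredAmpLp h s), Complex.conj_im] at h₁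
  simp at h₁
  linarith

end QuantumState

end CVSteering

/-! ### Schur complements as norms, and the joint uncertainty relation -/

namespace CVSteering

section Covariance

open Matrix

variable {E : Type*} [NormedAddCommGroup E] [InnerProductSpace ℂ E]
variable {ι α β γ : Type}
theorem block_symplecticForm_self [DecidableEq ι] [DecidableEq α] {a : α → ι}
    (ha : Function.Injective a) : block (symplecticForm ι) a a = symplecticForm α := by
  ext r s
  simp [block, symplecticForm, Matrix.one_apply, ha.eq_iff]

theorem block_symplecticForm_of_disjoint [DecidableEq ι] {a : α → ι} {b : β → ι}
    (hab : ∀ i j, a i ≠ b j) : block (symplecticForm ι) a b = 0 := by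
  ext r s
  simp [block, symplecticForm, hab]

theorem transpose_block {c : ι × Fin 2 → E} {V : Matrix (ι × Fin 2) (ι × Fin 2) ℝ}
    (hV : ∀ r s, V r s = 2 * (inner ℂ (c r) (c s)).re) (a : α → ι) (b : β → ι) :
    (block V a b)ᵀ = block V b a := by
  ext r s
  simp only [block, transpose_apply, submatrix_apply, hV]
  rw [← inner_conj_symm, Complex.conj_re]

variable [Fintype α] [Fintype β] [Fintype γ]

/-- The real linear combination `∑_r w_r c_r` over the modes selected by `a`. -/
noncomputable def modeSum (c : ι × Fin 2 → E) (a : α → ι) (w : α × Fin 2 → ℝ) : E :=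
  ∑ r, (w r : ℂ) • c (Prod.map a id r)

theorem inner_modeSum (c : ι × Fin 2 → E) (a : α → ι) (b : β → ι) (v : α × Fin 2 → ℝ)
    (w : β × Fin 2 → ℝ) :
    inner ℂ (modeSum c a v) (modeSum c b w) =
      ∑ r, ∑ s, (v r : ℂ) * (w s : ℂ) * inner ℂ (c (Prod.map a id r)) (c (Prod.map b id s)) := by
  simp only [modeSum, sum_inner, inner_smul_left, Complex.conj_ofReal]
  refine Finset.sum_congr rfl fun r _ => ?_
  simp only [inner_sum, inner_smul_right, Finset.mul_sum, mul_assoc]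

theorem re_inner_modeSum {c : ι × Fin 2 → E} {V : Matrix (ι × Fin 2) (ι × Fin 2) ℝ}
    (hV : ∀ r s, V r s = 2 * (inner ℂ (c r) (c s)).re) (a : α → ι) (b : β → ι)
    (v : α × Fin 2 → ℝ) (w : β × Fin 2 → ℝ) :
    2 * (inner ℂ (modeSum c a v) (modeSum c b w)).re = v ⬝ᵥ block V a b *ᵥ w := by
  rw [inner_modeSum]
  simp only [Complex.re_sum, dotProduct, mulVec, Finset.mul_sum]
  refine Finset.sum_congr rfl fun r _ => Finset.sum_congr rfl fun s _ => ?_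
  rw [← Complex.ofReal_mul, Complex.re_ofReal_mul, block, submatrix_apply, hV]
  ring

theorem im_inner_modeSum {c : ι × Fin 2 → E} {W : Matrix (ι × Fin 2) (ι × Fin 2) ℝ}
    (hW : ∀ r s, W r s = 2 * (inner ℂ (c r) (c s)).im) (a : α → ι) (b : β → ι)
    (v : α × Fin 2 → ℝ) (w : β × Fin 2 → ℝ) :
    2 * (inner ℂ (modeSum c a v) (modeSum c b w)).im = v ⬝ᵥ block W a b *ᵥ w := by
  rw [inner_modeSum]
  simp only [Complex.im_sum, dotProduct, mulVec, Finset.mul_sum]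
  refine Finset.sum_congr rfl fun r _ => Finset.sum_congr rfl fun s _ => ?_
  rw [← Complex.ofReal_mul, Complex.im_ofReal_mul, block, submatrix_apply, hW]
  ring

theorem symplecticForm_mul_self [DecidableEq α] :
    symplecticForm α * symplecticForm α = -1 := by
  rw [symplecticForm, ← mul_kronecker_mul, Matrix.one_mul]
  have h : (!![0, 1; -1, 0] : Matrix (Fin 2) (Fin 2) ℝ) * !![0, 1; -1, 0] = -1 := by
    ext i j
    fin_cases i <;> fin_cases j <;> simp
  rw [h]
  ext ⟨i, k⟩ ⟨j, l⟩
  by_cases h₁ : i = j <;> by_cases h₂ : k = l <;> simp [h₁, h₂]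

variable [DecidableEq ι] [DecidableEq α] {c : ι × Fin 2 → E}
  {V : Matrix (ι × Fin 2) (ι × Fin 2) ℝ}

/-- By the uncertainty relation, the covariance matrix of a group of modes is invertible. -/
theorem isUnit_det_block (hV : ∀ r s, V r s = 2 * (inner ℂ (c r) (c s)).re)
    (hΩ : ∀ r s, symplecticForm ι r s = 2 * (inner ℂ (c r) (c s)).im) {a : α → ι}
    (ha : Function.Injective a) : IsUnit (block V a a).det := by
  rw [isUnit_iff_ne_zero]
  intro h
  obtain ⟨w, hw, hw'⟩ := exists_mulVec_eq_zero_iff.2 h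
  -- A null vector `w` of `V_A` gives a combination of norm zero. Its pairings with all others then
  -- vanish, so `σ w = 0`, and `σ² = -1` forces `w = 0`.
  have h₀ : modeSum c a w = 0 := by
    have := re_inner_modeSum hV a a w w
    rw [hw', dotProduct_zero] at this
    rw [← norm_eq_zero, ← sq_eq_zero_iff, ← inner_self_eq_norm_sq (𝕜 := ℂ)]
    simpa using this
  have h₁ : symplecticForm α *ᵥ w = 0 := by
    refine dotProduct_eq_zero _ fun v => ?_
    rw [dotProduct_comm, ← block_symplecticForm_self ha, ← im_inner_modeSum hΩ a a v w, h₀,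
      inner_zero_right]
    simp
  apply hw
  have h₂ : symplecticForm α *ᵥ (symplecticForm α *ᵥ w) = 0 := by rw [h₁, mulVec_zero]
  rw [mulVec_mulVec, symplecticForm_mul_self, neg_mulVec, one_mulVec, neg_eq_zero] at h₂
  exact h₂

/-- The coefficients on `A` minimising the quadratic form of `V_AB` at the coefficients `x`
on `B`. -/
noncomputable def schurMin (V : Matrix (ι × Fin 2) (ι × Fin 2) ℝ) (a : α → ι) (b : β → ι)
    (x : β × Fin 2 → ℝ) : α × Fin 2 → ℝ :=
  -((block V a a)⁻¹ *ᵥ (block V a b *ᵥ x))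

/-- Completing the square: the A-coefficients `u` solve `V_A u = -V_AB x`, so the pure A term
cancels one of the two cross terms. -/
theorem norm_sq_schurMin (hV : ∀ r s, V r s = 2 * (inner ℂ (c r) (c s)).re)
    (hΩ : ∀ r s, symplecticForm ι r s = 2 * (inner ℂ (c r) (c s)).im) {a : α → ι}
    (ha : Function.Injective a) (b : β → ι) (x : β × Fin 2 → ℝ) :
    2 * ‖modeSum c a (schurMin V a b x) + modeSum c b x‖ ^ 2 =
      x ⬝ᵥ schurComplement V a b *ᵥ x := by
  have h₁ : block V a a *ᵥ schurMin V a b x = -(block V a b *ᵥ x) := by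
    rw [schurMin, mulVec_neg, mulVec_mulVec, mul_nonsing_inv _ (isUnit_det_block hV hΩ ha),
      one_mulVec]
  have h₂ : 2 * ‖modeSum c a (schurMin V a b x) + modeSum c b x‖ ^ 2 =
      schurMin V a b x ⬝ᵥ block V a a *ᵥ schurMin V a b x
        + schurMin V a b x ⬝ᵥ block V a b *ᵥ x + x ⬝ᵥ block V b a *ᵥ schurMin V a b x
        + x ⬝ᵥ block V b b *ᵥ x := by
    rw [← inner_self_eq_norm_sq (𝕜 := ℂ), ← re_inner_modeSum hV, ← re_inner_modeSum hV,
      ← re_inner_modeSum hV, ← re_inner_modeSum hV]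
    simp only [inner_add_left, inner_add_right, map_add, RCLike.re_eq_complex_re]
    ring
  rw [h₂, h₁, schurComplement, transpose_block hV, sub_mulVec, dotProduct_sub, dotProduct_neg,
    neg_add_cancel, zero_add, schurMin, mulVec_neg, dotProduct_neg, ← mulVec_mulVec,
    ← mulVec_mulVec]
  ring

/-- The uncertainty relation between the conditional states of `B` given `A` and given `C`. -/
theorem sq_symplecticForm_le [DecidableEq β] [DecidableEq γ]
    (hV : ∀ r s, V r s = 2 * (inner ℂ (c r) (c s)).re)
    (hΩ : ∀ r s, symplecticForm ι r s = 2 * (inner ℂ (c r) (c s)).im) {a : α → ι} {b : β → ι}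
    {d : γ → ι} (ha : Function.Injective a) (hb : Function.Injective b)
    (hd : Function.Injective d) (hab : ∀ i j, a i ≠ b j) (had : ∀ i j, a i ≠ d j)
    (hbd : ∀ i j, b i ≠ d j) (x y : β × Fin 2 → ℝ) :
    (x ⬝ᵥ symplecticForm β *ᵥ y) ^ 2 ≤
      (x ⬝ᵥ schurComplement V a b *ᵥ x) * (y ⬝ᵥ schurComplement V d b *ᵥ y) := by
  rw [← norm_sq_schurMin hV hΩ ha, ← norm_sq_schurMin hV hΩ hd]
  set u := schurMin V a b x
  set v := schurMin V d b y
  -- The A-C, A-B and B-C pairings have zero imaginary part because the groups are disjoint; only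
  -- B-B survives.
  have h : x ⬝ᵥ symplecticForm β *ᵥ y =
      2 * (inner ℂ (modeSum c a u + modeSum c b x) (modeSum c d v + modeSum c b y)).im := by
    simp only [inner_add_left, inner_add_right, Complex.add_im, mul_add, im_inner_modeSum hΩ,
      block_symplecticForm_self hb, block_symplecticForm_of_disjoint hab,
      block_symplecticForm_of_disjoint had, block_symplecticForm_of_disjoint hbd, zero_mulVec,
      dotProduct_zero, add_zero, zero_add]
  rw [h]
  have h₁ := (Complex.abs_im_le_norm _).trans (norm_inner_le_norm (𝕜 := ℂ)
    (modeSum c a u + modeSum c b x) (modeSum c d v + modeSum c b y))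
  have h₂ := sq_le_sq' (neg_le_of_abs_le h₁) (le_of_abs_le h₁)
  linarith

omit [Fintype β] [DecidableEq ι] in
theorem schurComplement_comm (hV : ∀ r s, V r s = 2 * (inner ℂ (c r) (c s)).re) (a : α → ι)
    (b : β → ι) (r s : β × Fin 2) : schurComplement V a b r s = schurComplement V a b s r := by
  have h : (schurComplement V a b)ᵀ = schurComplement V a b := by
    rw [schurComplement, transpose_sub, transpose_mul, transpose_mul, transpose_transpose,
      transpose_nonsing_inv, transpose_block hV, transpose_block hV, transpose_block hV, Matrix.mul_assoc]
  exact congrFun₂ h s r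

end Covariance

/-! ### Bona fide criterion and dichotomy for a single mode -/

section SingleMode

open Matrix

theorem dotProduct_mulVec_singleMode (M : Matrix (Fin 1 × Fin 2) (Fin 1 × Fin 2) ℝ)
    (x y : Fin 1 × Fin 2 → ℝ) :
    x ⬝ᵥ M *ᵥ y = x (0, 0) * (M (0, 0) (0, 0) * y (0, 0) + M (0, 0) (0, 1) * y (0, 1))
      + x (0, 1) * (M (0, 1) (0, 0) * y (0, 0) + M (0, 1) (0, 1) * y (0, 1)) := by
  simp [dotProduct, mulVec, Fintype.sum_prod_type]

theorem isBonaFide_singleMode {M : Matrix (Fin 1 × Fin 2) (Fin 1 × Fin 2) ℝ}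
    (hM : ∀ r s, M r s = M s r) (hpos : 0 < M (0, 0) (0, 0))
    (hdet : 1 ≤ M (0, 0) (0, 0) * M (0, 1) (0, 1) - M (0, 0) (0, 1) ^ 2) : IsBonaFide M := by
  refine PosSemidef.of_dotProduct_mulVec_nonneg ?_ fun z => ?_
  · ext ⟨i, k⟩ ⟨j, l⟩
    fin_cases i
    fin_cases j
    fin_cases k <;> fin_cases l <;> simp [symplecticForm, hM (0, 1) (0, 0)]
  · have h₁₀ := hM (0, 1) (0, 0)
    obtain ⟨p, hp⟩ : ∃ p, p = M (0, 0) (0, 0) := ⟨_, rfl⟩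
    obtain ⟨q, hq⟩ : ∃ q, q = M (0, 0) (0, 1) := ⟨_, rfl⟩
    obtain ⟨r, hr⟩ : ∃ r, r = M (0, 1) (0, 1) := ⟨_, rfl⟩
    obtain ⟨a, ha⟩ : ∃ a, a = z (0, 0) := ⟨_, rfl⟩
    obtain ⟨b, hb⟩ : ∃ b, b = z (0, 1) := ⟨_, rfl⟩
    rw [← hp] at hpos
    rw [← hp, ← hq, ← hr] at hdet
    have h : star z ⬝ᵥ (M.map Complex.ofReal
        + Complex.I • (symplecticForm (Fin 1)).map Complex.ofReal) *ᵥ z =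
        ((p * (a.re ^ 2 + a.im ^ 2) + 2 * q * (a.re * b.re + a.im * b.im)
          + r * (b.re ^ 2 + b.im ^ 2) - 2 * (a.re * b.im - a.im * b.re) : ℝ) : ℂ) := by
      simp only [dotProduct, mulVec, Fintype.sum_prod_type, Fin.sum_univ_two, Finset.univ_unique,
        Finset.sum_singleton, Fin.default_eq_zero]
      simp only [symplecticForm, Matrix.add_apply, map_apply, Matrix.smul_apply, kroneckerMap_apply, h₁₀,
        Pi.star_apply, ← ha, ← hb, ← hp, ← hq, ← hr]
      apply Complex.ext
      · rw [Complex.ofReal_re]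
        simp
        ring
      · rw [Complex.ofReal_im]
        simp
        ring
    rw [h, Complex.zero_le_real]
    refine nonneg_of_mul_nonneg_right (a := p) ?_ hpos
    -- `p` times the form equals `|p a + (q + i) b|² + (p r - q² - 1)|b|²`; the first two hints are
    -- the real and imaginary parts of that square.
    nlinarith [sq_nonneg (p * a.re + q * b.re - b.im), sq_nonneg (p * a.im + q * b.im + b.re),
      mul_nonneg (sub_nonneg.2 hdet) (add_nonneg (sq_nonneg b.re) (sq_nonneg b.im))]

/-- Of two positive single-mode matrices satisfying a joint uncertainty relation, at least one is
a bona fide covariance matrix. -/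
theorem isBonaFide_or_of_uncertainty {M N : Matrix (Fin 1 × Fin 2) (Fin 1 × Fin 2) ℝ}
    (hM : ∀ r s, M r s = M s r) (hN : ∀ r s, N r s = N s r)
    (hM₀ : ∀ x, 0 ≤ x ⬝ᵥ M *ᵥ x) (hN₀ : ∀ x, 0 ≤ x ⬝ᵥ N *ᵥ x)
    (h : ∀ x y, (x ⬝ᵥ symplecticForm (Fin 1) *ᵥ y) ^ 2 ≤ (x ⬝ᵥ M *ᵥ x) * (y ⬝ᵥ N *ᵥ y)) :
    IsBonaFide M ∨ IsBonaFide N := by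
  have hM₁ := hM (0, 1) (0, 0)
  have hN₁ := hN (0, 1) (0, 0)
  obtain ⟨m, hm⟩ : ∃ m, m = M (0, 0) (0, 0) := ⟨_, rfl⟩
  obtain ⟨m', hm'⟩ : ∃ m', m' = M (0, 0) (0, 1) := ⟨_, rfl⟩
  obtain ⟨m'', hm''⟩ : ∃ m'', m'' = M (0, 1) (0, 1) := ⟨_, rfl⟩
  obtain ⟨n, hn⟩ : ∃ n, n = N (0, 0) (0, 0) := ⟨_, rfl⟩
  obtain ⟨n', hn'⟩ : ∃ n', n' = N (0, 0) (0, 1) := ⟨_, rfl⟩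
  obtain ⟨n'', hn''⟩ : ∃ n'', n'' = N (0, 1) (0, 1) := ⟨_, rfl⟩
  let vec (s t : ℝ) : Fin 1 × Fin 2 → ℝ := fun r => ![s, t] r.2
  have hform (s t s' t' : ℝ) : (s * t' - t * s') ^ 2 ≤
      (m * s ^ 2 + 2 * m' * s * t + m'' * t ^ 2) *
        (n * s' ^ 2 + 2 * n' * s' * t' + n'' * t' ^ 2) := by
    have := h (vec s t) (vec s' t')
    simp only [dotProduct_mulVec_singleMode, hM₁, hN₁, ← hm, ← hm', ← hm'', ← hn, ← hn', ← hn'',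
      vec, symplecticForm, kroneckerMap_apply] at this
    simp at this
    linarith
  have hm₀ : 0 ≤ m := by
    have := hM₀ (vec 1 0)
    simpa [dotProduct_mulVec_singleMode, ← hm, vec] using this
  have hn₀ : 0 ≤ n := by
    have := hN₀ (vec 1 0)
    simpa [dotProduct_mulVec_singleMode, ← hn, vec] using this
  have hmpos : 0 < m := by
    refine hm₀.lt_of_ne' fun h₀ => ?_
    have := hform 1 0 0 1
    rw [h₀] at this
    norm_num at this
  have hnpos : 0 < n := by
    refine hn₀.lt_of_ne' fun h₀ => ?_
    have := hform 0 1 1 0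
    rw [h₀] at this
    norm_num at this
  set D := m * m'' - m' ^ 2 with hD
  set F := n * n'' - n' ^ 2 with hF
  -- `(-n', n)` minimises the form of `N` at fixed second coordinate and has value `n * F`; its
  -- symplectic product with `(1, 0)` is `n`.
  have h₁ : n ≤ m * F := by
    have := hform 1 0 (-n') n
    have h₂ : n * n ≤ n * (m * F) := by rw [hF]; nlinarith
    exact le_of_mul_le_mul_left h₂ hnpos
  have h₂ : m ≤ n * D := by
    have := hform (-m') m 1 0
    have h₂ : m * m ≤ m * (n * D) := by rw [hD]; nlinarith
    exact le_of_mul_le_mul_left h₂ hmpos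
  -- If `D ≤ 1`, then `m ≤ n * D ≤ n ≤ m * F`, hence `F ≥ 1`.
  rcases le_total 1 D with h₃ | h₃
  · left
    exact isBonaFide_singleMode hM (hm ▸ hmpos) (by rw [← hm, ← hm', ← hm'']; exact h₃)
  · right
    refine isBonaFide_singleMode hN (hn ▸ hnpos) ?_
    rw [← hn, ← hn', ← hn'']
    nlinarith

end SingleMode

end CVSteering
-- Conclusion for quantum states
namespace CVSteering

/-- Two groups of modes cannot both steer a third group consisting of a single mode. -/
theorem not_gaussianSteerable_and {ι α γ : Type} [Fintype ι] [DecidableEq ι] [Fintype α]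
    [DecidableEq α] [Fintype γ] [DecidableEq γ] (ρ : QuantumState ι)
    (h : ρ.HasFiniteSecondMoments) {a : α → ι} {b : Fin 1 → ι} {d : γ → ι}
    (ha : Function.Injective a) (hb : Function.Injective b) (hd : Function.Injective d)
    (hab : ∀ i j, a i ≠ b j) (had : ∀ i j, a i ≠ d j) (hbd : ∀ i j, b i ≠ d j) :
    ¬ (GaussianSteerable ρ h a b ∧ GaussianSteerable ρ h d b) := by
  have hV := ρ.covMatrix_eq_re_inner h
  have hΩ := ρ.symplecticForm_eq_im_inner h
  rw [GaussianSteerable, GaussianSteerable, ← not_or, not_not]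
  refine isBonaFide_or_of_uncertainty (schurComplement_comm hV a b) (schurComplement_comm hV d b)
    (fun x => ?_) (fun x => ?_) (sq_symplecticForm_le hV hΩ ha hb hd hab had hbd)
  · rw [← norm_sq_schurMin hV hΩ ha]
    positivity
  · rw [← norm_sq_schurMin hV hΩ hd]
    positivity

end CVSteering

theorem theorem3 (nA nC : ℕ)
    (ρ : CVSteering.QuantumState (Fin nA ⊕ Fin 1 ⊕ Fin nC))
    (hρ : ρ.HasFiniteSecondMoments) :
    ¬ (CVSteering.GaussianSteerable ρ hρ
          (Sum.inl : Fin nA → Fin nA ⊕ Fin 1 ⊕ Fin nC)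
          (Sum.inr ∘ Sum.inl : Fin 1 → Fin nA ⊕ Fin 1 ⊕ Fin nC)
        ∧ CVSteering.GaussianSteerable ρ hρ
          (Sum.inr ∘ Sum.inr : Fin nC → Fin nA ⊕ Fin 1 ⊕ Fin nC)
          (Sum.inr ∘ Sum.inl : Fin 1 → Fin nA ⊕ Fin 1 ⊕ Fin nC)) := by
  exact CVSteering.not_gaussianSteerable_and ρ hρ Sum.inl_injective
    (Sum.inr_injective.comp Sum.inl_injective) (Sum.inr_injective.comp Sum.inr_injective)
    (by simp) (by simp) (by simp)
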